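/- Let $K$ be a number field of degree $n = [K:\mathbb{Q}]$ with ring of integers $O_K$, and let $r$ be the rank of the unit group $O_K^\times$. For a nonzero prime ideal $\mathfrak{p}$ of $O_K$ and $t \in K$, let $\mathrm{ord}_{\mathfrak{p}}(t) \in \mathbb{Z} \cup \{\infty\}$ be the exponent of $\mathfrak{p}$ in the factorization of the fractional ideal $tO_K$ (with $\mathrm{ord}_{\mathfrak{p}}(0) = \infty$), and let $H(t) = \prod_v \max(|t|_v, 1)^{n_v/n}$ be the absolute multiplicative height of $t$, where $v$ runs over the absolute values of $K$ extending the standard absolute values of $\mathbb{Q}$ and $n_v$ is the local degree at $v$. For a finite set $S$ of nonzero prime ideals of $O_K$ put \[ E^*_S = \{t \in K : \mathrm{ord}_{\mathfrak{p}}(t) \neq -1 \text{ for all } \mathfrak{p} \notin S\}. \] Then for every integer $s \ge 0$ there is a constant $C$, depending only on $K$ and $s$, such that for every set $S$ of exactly $s$ nonzero prime ideals of $O_K$ and every real $X \ge 2$, the set $\{t \in E^*_S : H(t) \le X\}$ is finite and \[ \#\{t \in E^*_S : H(t) \le X\} \le C\, X^{3n/2} (\log X)^r . \] -/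

import Mathlib

open NumberField IsDedekindDomain

noncomputable section

namespace NumberField

variable {K : Type*} [Field K] [NumberField K]

/-- The `𝔭`-adic valuation `ord_𝔭 : K → ℤ ∪ {∞}`: the exponent of `𝔭` in the factorization of
the fractional ideal `t O_K` if `t ≠ 0`, and `ord_𝔭(0) = ∞`. -/
def primeOrd (𝔭 : HeightOneSpectrum (𝓞 K)) (t : K) : WithTop ℤ :=
  open Classical in
  if t = 0 then ⊤
  else ((FractionalIdeal.count K 𝔭
    (FractionalIdeal.spanSingleton (nonZeroDivisors (𝓞 K)) t) : ℤ) : WithTop ℤ)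

/-- The absolute multiplicative height `H(t) = ∏_v max(|t|_v, 1) ^ (n_v / n)` of `t ∈ K`, that is,
of the point `(t : 1)` of the projective line, where `n = [K : ℚ]`.
Mathlib's `Height.mulHeight₁` is the product of the `max(|t|_v ^ n_v, 1)`
(see `NumberField.mulHeight₁_eq`). -/
def absHeight (t : K) : ℝ :=
  Height.mulHeight₁ t ^ ((1 : ℝ) / (Module.finrank ℚ K : ℝ))

/-- The elements of `A` of height at most `X`. -/
def upToHeight (A : Set K) (X : ℝ) : Set K :=
  {t : K | t ∈ A ∧ absHeight t ≤ X}

/-- The counting function `N(A, X) = #{t ∈ A : H(t) ≤ X}` (the set is finite). -/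
def heightCount (A : Set K) (X : ℝ) : ℕ :=
  (upToHeight A X).ncard

/-- The set `E^*` of all `t ∈ K` with `ord_𝔭(t) ≠ -1` for all primes `𝔭 ∉ S`. -/
def noSimplePoleOutside (S : Finset (HeightOneSpectrum (𝓞 K))) : Set K :=
  {t : K | ∀ 𝔭 : HeightOneSpectrum (𝓞 K), 𝔭 ∉ S → primeOrd 𝔭 t ≠ ((-1 : ℤ) : WithTop ℤ)}

end NumberField

end

noncomputable section

namespace NumberField

variable {K : Type*} [Field K] [NumberField K]

/-! Sort the elements by their denominator ideal. By `mulHeight₁_eq_prod_mul_expNorm`, `H(t) ^ n` is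
an archimedean factor, at least 1, times the norm of that ideal. For `t ∈ E*_S` of height at most
`X` the denominator therefore has norm at most `X ^ n`, and it is squarefull away from `S`;
`exists_card_almost_squarefull_le` leaves `O(X ^ (n/2))` such ideals.

For a fixed denominator `e`, the archimedean region `∏ max(|t|_v, 1) ^ n_v ≤ X ^ n / N(e)` is
covered by `O((log X) ^ r)` dyadic boxes. The product formula keeps two elements with denominator
`e` apart: `∏ |t - u|_v ^ n_v ≥ 1 / N(e)`. Hence a box contains `O(X ^ n)` of them, the norm `N(e)`
cancelling. Multiplying the two counts gives the bound. -/

/-! ### Exponent vectors and the number of ideals of bounded norm -/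

/-- The norm `∏ N(𝔭) ^ e(𝔭)` of the ideal with exponents `e`. -/
def expNorm (e : HeightOneSpectrum (𝓞 K) →₀ ℕ) : ℕ :=
  e.prod fun v k => Ideal.absNorm v.asIdeal ^ k

/-- The integral ideal with exponents `e`. -/
def expIdeal (e : HeightOneSpectrum (𝓞 K) →₀ ℕ) : Ideal (𝓞 K) :=
  e.prod fun v k => v.asIdeal ^ k

lemma absNorm_expIdeal (e : HeightOneSpectrum (𝓞 K) →₀ ℕ) :
    Ideal.absNorm (expIdeal e) = expNorm e := by
  simp [expIdeal, expNorm, Finsupp.prod, map_prod]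

lemma one_le_expNorm (e : HeightOneSpectrum (𝓞 K) →₀ ℕ) : 1 ≤ expNorm e :=
  Finset.one_le_prod' fun v _ => Nat.one_le_pow _ _ (by
    have := HeightOneSpectrum.one_lt_absNorm v; omega)

lemma expIdeal_injective :
    Function.Injective (expIdeal : (HeightOneSpectrum (𝓞 K) →₀ ℕ) → Ideal (𝓞 K)) := by
  classical
  have key (e : HeightOneSpectrum (𝓞 K) →₀ ℕ) (v : HeightOneSpectrum (𝓞 K)) :
      FractionalIdeal.count K v (expIdeal e : FractionalIdeal (nonZeroDivisors (𝓞 K)) K) = e v := by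
    have h := FractionalIdeal.count_finsuppProd K v (e.mapRange (fun n : ℕ => (n : ℤ)) rfl)
    rw [Finsupp.mapRange_apply, Finsupp.prod_mapRange_index (by simp)] at h
    rw [← h, expIdeal]
    congr 1
    simp only [Finsupp.prod, zpow_natCast]
    rw [← FractionalIdeal.coeIdealHom_apply, map_prod]
    simp only [FractionalIdeal.coeIdealHom_apply, FractionalIdeal.coeIdeal_pow]
  intro a b hab
  ext v
  have := key a v
  rw [hab, key b v] at this
  exact_mod_cast this.symm

variable (K) in
-- The number of ideals of norm at most `m`, divided by `m`, converges, so it is bounded.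
lemma exists_card_expNorm_le : ∃ C : ℝ, 0 ≤ C ∧ ∀ x : ℝ, 0 ≤ x →
    ∀ F : Finset (HeightOneSpectrum (𝓞 K) →₀ ℕ), (∀ a ∈ F, (expNorm a : ℝ) ≤ x) →
      (F.card : ℝ) ≤ C * x := by
  obtain ⟨C, hC⟩ := ((Ideal.tendsto_norm_le_div_atTop K).comp
    tendsto_natCast_atTop_atTop).bddAbove_range
  have hC' (n : ℕ) : (Nat.card {I : Ideal (𝓞 K) // Ideal.absNorm I ≤ n} : ℝ) / n ≤ C := by
    have := hC ⟨n, rfl⟩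
    simpa using this
  -- At index 0 the quotient is 0, by the convention for division by zero.
  have hC0 : 0 ≤ C := by simpa using hC' 0
  refine ⟨C, hC0, fun x hx F hF => ?_⟩
  rcases F.eq_empty_or_nonempty with rfl | ⟨a₀, ha₀⟩
  · simpa using mul_nonneg hC0 hx
  have hx1 : 1 ≤ x := le_trans (by exact_mod_cast one_le_expNorm a₀) (hF _ ha₀)
  have hn : (0 : ℝ) < ⌊x⌋₊ := by exact_mod_cast Nat.floor_pos.2 hx1
  have hle : F.card ≤ Nat.card {I : Ideal (𝓞 K) // Ideal.absNorm I ≤ ⌊x⌋₊} := by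
    have hfin : {I : Ideal (𝓞 K) | Ideal.absNorm I ≤ ⌊x⌋₊}.Finite :=
      Ideal.finite_setOfPred_absNorm_le _
    change F.card ≤ Nat.card ↥{I : Ideal (𝓞 K) | Ideal.absNorm I ≤ ⌊x⌋₊}
    rw [Nat.card_eq_card_finite_toFinset hfin, ← Finset.card_image_of_injective F
      expIdeal_injective]
    refine Finset.card_le_card fun I hI => ?_
    obtain ⟨a, ha, rfl⟩ := Finset.mem_image.1 hI
    simp only [Set.Finite.mem_toFinset, Set.mem_ofPred_eq, absNorm_expIdeal]
    exact Nat.le_floor (hF a ha)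
  calc (F.card : ℝ) ≤ (Nat.card {I : Ideal (𝓞 K) // Ideal.absNorm I ≤ ⌊x⌋₊} : ℝ) := by
        exact_mod_cast hle
    _ ≤ C * ⌊x⌋₊ := (div_le_iff₀ hn).1 (hC' _)
    _ ≤ C * x := by gcongr; exact Nat.floor_le hx

variable (K) in
-- Dyadic summation: at most `2C · 2 ^ k` ideals have norm in `[2 ^ k, 2 ^ (k+1))`, each
-- contributing at most `2 ^ (-3k/2)`, which leaves a geometric series of ratio `2 ^ (-1/2)`.
lemma exists_sum_expNorm_rpow_le : ∃ C : ℝ, 0 ≤ C ∧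
    ∀ F : Finset (HeightOneSpectrum (𝓞 K) →₀ ℕ),
      ∑ a ∈ F, (expNorm a : ℝ) ^ (-(3 / 2) : ℝ) ≤ C := by
  classical
  obtain ⟨C, hC0, hC⟩ := exists_card_expNorm_le K
  set ρ : ℝ := 2 ^ (-(1 / 2) : ℝ) with hρ
  have hρ0 : 0 ≤ ρ := by positivity
  have hρ1 : ρ < 1 := Real.rpow_lt_one_of_one_lt_of_neg (by norm_num) (by norm_num)
  refine ⟨2 * C * (1 - ρ)⁻¹, by have := sub_pos.2 hρ1; positivity, fun F => ?_⟩
  obtain ⟨m, hm⟩ : ∃ m, ∀ a ∈ F, Nat.log 2 (expNorm a) ∈ Finset.range m := by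
    refine ⟨F.sup (fun a => Nat.log 2 (expNorm a)) + 1, fun a ha => ?_⟩
    exact Finset.mem_range.2 (Nat.lt_succ_of_le
      (Finset.le_sup (f := fun a => Nat.log 2 (expNorm a)) ha))
  rw [← Finset.sum_fiberwise_of_maps_to hm]
  calc _ ≤ ∑ k ∈ Finset.range m, 2 * C * ρ ^ k := by
        refine Finset.sum_le_sum fun k _ => ?_
        have h1 : ∀ a ∈ F.filter (fun a => Nat.log 2 (expNorm a) = k),
            (expNorm a : ℝ) ^ (-(3 / 2) : ℝ) ≤ ((2 : ℝ) ^ k) ^ (-(3 / 2) : ℝ) := by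
          intro a ha
          have hk := (Finset.mem_filter.1 ha).2
          have : 2 ^ k ≤ expNorm a := hk ▸ Nat.pow_log_le_self 2 (by
            have := one_le_expNorm a; omega)
          exact Real.rpow_le_rpow_of_nonpos (by positivity) (by exact_mod_cast this) (by norm_num)
        have h2 := hC (2 ^ (k + 1)) (by positivity)
          (F.filter (fun a => Nat.log 2 (expNorm a) = k)) (by
            intro a ha
            have hk := (Finset.mem_filter.1 ha).2
            have : expNorm a < 2 ^ (k + 1) := hk ▸ Nat.lt_pow_succ_log_self (by norm_num) _
            exact_mod_cast this.le)
        refine (Finset.sum_le_card_nsmul _ _ _ h1).trans ?_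
        rw [nsmul_eq_mul]
        refine (mul_le_mul_of_nonneg_right h2 (by positivity)).trans (le_of_eq ?_)
        have h3 : ρ ^ k = ((2 : ℝ) ^ k) ^ (-(1 / 2) : ℝ) := by
          rw [hρ, ← Real.rpow_natCast, ← Real.rpow_natCast, ← Real.rpow_mul (by norm_num),
            ← Real.rpow_mul (by norm_num), mul_comm]
        have h4 : (2 : ℝ) ^ k * ((2 : ℝ) ^ k) ^ (-(3 / 2) : ℝ) = ((2 : ℝ) ^ k) ^ (-(1 / 2) : ℝ) := by
          rw [← Real.rpow_one_add' (by positivity) (by norm_num)]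
          norm_num
        rw [h3, ← h4, pow_succ]
        ring
    _ = 2 * C * ∑ k ∈ Finset.range m, ρ ^ k := by rw [Finset.mul_sum]
    _ ≤ 2 * C * (1 - ρ)⁻¹ := by
        gcongr
        rw [← tsum_geometric_of_lt_one hρ0 hρ1]
        exact (summable_geometric_of_lt_one hρ0 hρ1).sum_le_tsum _ (fun _ _ => by positivity)

/-! ### Ideals that are squarefull outside `S` -/

lemma expNorm_eq_prod (e : HeightOneSpectrum (𝓞 K) →₀ ℕ) {T : Finset (HeightOneSpectrum (𝓞 K))}
    (h : e.support ⊆ T) : expNorm e = ∏ v ∈ T, Ideal.absNorm v.asIdeal ^ e v :=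
  Finsupp.prod_of_support_subset e h _ (by simp)

variable (K) in
-- Such an ideal is `𝔞² 𝔡³` times a product of distinct primes of `S`, with at most `2 ^ s` choices
-- for the latter. Given `𝔡`, there are `O(Y ^ (1/2) N(𝔡) ^ (-3/2))` ideals `𝔞`, and the sum over
-- `𝔡` converges.
lemma exists_card_almost_squarefull_le (s : ℕ) : ∃ C : ℝ, 0 ≤ C ∧
    ∀ S : Finset (HeightOneSpectrum (𝓞 K)), S.card = s → ∀ Y : ℝ, 0 ≤ Y →
      ∀ F : Finset (HeightOneSpectrum (𝓞 K) →₀ ℕ),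
        (∀ e ∈ F, (expNorm e : ℝ) ≤ Y ∧ ∀ v ∉ S, e v ≠ 1) → (F.card : ℝ) ≤ C * Y ^ (1 / 2 : ℝ) := by
  classical
  obtain ⟨C₁, hC₁0, hC₁⟩ := exists_card_expNorm_le K
  obtain ⟨C₂, hC₂0, hC₂⟩ := exists_sum_expNorm_rpow_le K
  refine ⟨2 ^ s * (C₁ * C₂), by positivity, fun S hS Y hY F hF => ?_⟩
  -- For `k ≠ 1` this is `k = 2α + 3δ`, with `δ` the parity of `k`. At `k = 1` both vanish, as at `k
  -- = 0`; the subset `fc` of `S` tells these two cases apart.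
  let α : ℕ → ℕ := fun k => if k % 2 = 0 then k / 2 else (k - 3) / 2
  let δ : ℕ → ℕ := fun k => if k % 2 = 0 ∨ k = 1 then 0 else 1
  have hαδ (k : ℕ) : 2 * α k + 3 * δ k ≤ k := by
    simp only [α, δ]; split_ifs <;> omega
  let fa : (HeightOneSpectrum (𝓞 K) →₀ ℕ) → (HeightOneSpectrum (𝓞 K) →₀ ℕ) :=
    fun e => e.mapRange α rfl
  let fd : (HeightOneSpectrum (𝓞 K) →₀ ℕ) → (HeightOneSpectrum (𝓞 K) →₀ ℕ) :=
    fun e => e.mapRange δ rfl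
  let fc : (HeightOneSpectrum (𝓞 K) →₀ ℕ) → Finset (HeightOneSpectrum (𝓞 K)) :=
    fun e => S.filter (fun v => e v = 1)
  have hnorm (e) : (expNorm (fa e) : ℝ) ^ 2 * (expNorm (fd e) : ℝ) ^ 3 ≤ expNorm e := by
    have : expNorm (fa e) ^ 2 * expNorm (fd e) ^ 3 ≤ expNorm e := by
      rw [expNorm_eq_prod (fa e) (Finsupp.support_mapRange (f := α) (hf := rfl)),
        expNorm_eq_prod (fd e) (Finsupp.support_mapRange (f := δ) (hf := rfl)),
        expNorm_eq_prod e subset_rfl, ← Finset.prod_pow, ← Finset.prod_pow,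
        ← Finset.prod_mul_distrib]
      refine Finset.prod_le_prod' fun v _ => ?_
      rw [← pow_mul, ← pow_mul, ← pow_add]
      refine Nat.pow_le_pow_right (by have := HeightOneSpectrum.one_lt_absNorm v; omega) ?_
      have := hαδ (e v)
      simp only [fa, fd, Finsupp.mapRange_apply]
      omega
    exact_mod_cast this
  have hinj : Set.InjOn (fun e => (fc e, fd e, fa e)) F := by
    intro e he e' he' h
    simp only [Prod.mk.injEq] at h
    obtain ⟨h1, h2, h3⟩ := h
    ext v
    have h2 := DFunLike.congr_fun h2 v
    have h3 := DFunLike.congr_fun h3 v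
    have h1 : v ∈ fc e ↔ v ∈ fc e' := by rw [h1]
    have h4 := (hF e he).2 v
    have h5 := (hF e' he').2 v
    simp only [fc, fd, fa, Finset.mem_filter, Finsupp.mapRange_apply, α, δ] at h1 h2 h3
    by_cases hv : v ∈ S
    · simp only [hv, true_and] at h1
      split_ifs at h2 h3 <;> omega
    · have := h4 hv
      have := h5 hv
      split_ifs at h2 h3 <;> omega
  have hcard : F.card ≤ 2 ^ s * (F.image fun e => (fd e, fa e)).card := by
    rw [← hS, ← Finset.card_powerset, ← Finset.card_product]
    refine Finset.card_le_card_of_injOn _ (fun e he => ?_) hinj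
    simp only [Finset.coe_product, Set.mem_prod, Finset.mem_coe, Finset.mem_powerset]
    exact ⟨Finset.filter_subset _ _, Finset.mem_image_of_mem _ he⟩
  have hcard2 : ((F.image fun e => (fd e, fa e)).card : ℝ) ≤ C₁ * C₂ * Y ^ (1 / 2 : ℝ) := by
    rw [Finset.card_eq_sum_card_fiberwise (f := Prod.fst) (t := F.image fd) (by
      intro p hp
      simp only [Finset.coe_image, Set.mem_image, Finset.mem_coe] at hp ⊢
      obtain ⟨e, he, rfl⟩ := hp
      exact ⟨e, he, rfl⟩)]
    push_cast
    calc _ ≤ ∑ d ∈ F.image fd, C₁ * (Y ^ (1 / 2 : ℝ) * (expNorm d : ℝ) ^ (-(3 / 2) : ℝ)) := by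
          refine Finset.sum_le_sum fun d _ => ?_
          set G := (F.image fun e => (fd e, fa e)).filter (fun p => p.1 = d) with hG
          have hGi : G.card = (G.image Prod.snd).card := by
            refine (Finset.card_image_of_injOn ?_).symm
            intro p hp q hq h
            have hp := (Finset.mem_filter.1 hp).2
            have hq := (Finset.mem_filter.1 hq).2
            exact Prod.ext (hp.trans hq.symm) h
          rw [hGi]
          refine hC₁ _ (by positivity) _ fun a ha => ?_
          obtain ⟨p, hp, rfl⟩ := Finset.mem_image.1 ha
          obtain ⟨hp', rfl⟩ := Finset.mem_filter.1 hp
          obtain ⟨e, he, rfl⟩ := Finset.mem_image.1 hp'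
          have hd : (0 : ℝ) < expNorm (fd e) := by exact_mod_cast one_le_expNorm _
          have h1 : (expNorm (fa e) : ℝ) ^ 2 ≤ Y / (expNorm (fd e) : ℝ) ^ 3 := by
            rw [le_div_iff₀ (by positivity)]
            exact (hnorm e).trans (hF e he).1
          have h2 := Real.rpow_le_rpow (by positivity) h1 (by norm_num : (0 : ℝ) ≤ 1 / 2)
          rw [← Real.sqrt_eq_rpow, Real.sqrt_sq (by positivity),
            Real.div_rpow hY (by positivity)] at h2
          refine h2.trans (le_of_eq ?_)
          rw [Real.rpow_neg hd.le, ← Real.rpow_natCast, ← Real.rpow_mul hd.le, div_eq_mul_inv]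
          norm_num
      _ = C₁ * Y ^ (1 / 2 : ℝ) * ∑ d ∈ F.image fd, (expNorm d : ℝ) ^ (-(3 / 2) : ℝ) := by
          rw [Finset.mul_sum]
          exact Finset.sum_congr rfl fun _ _ => by ring
      _ ≤ C₁ * Y ^ (1 / 2 : ℝ) * C₂ := by gcongr; exact hC₂ _
      _ = _ := by ring
  calc (F.card : ℝ) ≤ 2 ^ s * ((F.image fun e => (fd e, fa e)).card : ℝ) := by exact_mod_cast hcard
    _ ≤ 2 ^ s * (C₁ * C₂ * Y ^ (1 / 2 : ℝ)) := by gcongr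
    _ = _ := by ring

/-! ### Denominator ideals and the finite part of the height -/

/-- The exponent of `𝔭` in the fractional ideal `t O_K`, with the value `0` for `t = 0`. -/
def ordCount (𝔭 : HeightOneSpectrum (𝓞 K)) (t : K) : ℤ :=
  FractionalIdeal.count K 𝔭 (FractionalIdeal.spanSingleton (nonZeroDivisors (𝓞 K)) t)

lemma finite_ordCount_ne_zero (t : K) : {𝔭 | ordCount 𝔭 t ≠ 0}.Finite :=
  Filter.eventually_cofinite.1 (FractionalIdeal.finite_factors
    (FractionalIdeal.spanSingleton (nonZeroDivisors (𝓞 K)) t))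

/-- The exponents of the denominator ideal of `t`. -/
def poleOrd (t : K) : HeightOneSpectrum (𝓞 K) →₀ ℕ :=
  Finsupp.ofSupportFinite (fun 𝔭 => (-ordCount 𝔭 t).toNat)
    ((finite_ordCount_ne_zero t).subset fun 𝔭 h => by
      contrapose! h
      simp_all)

lemma poleOrd_apply (t : K) (𝔭 : HeightOneSpectrum (𝓞 K)) :
    poleOrd t 𝔭 = (-ordCount 𝔭 t).toNat := rfl

lemma poleOrd_ne_one {S : Finset (HeightOneSpectrum (𝓞 K))} {t : K}
    (ht : t ∈ noSimplePoleOutside S) {𝔭 : HeightOneSpectrum (𝓞 K)} (h : 𝔭 ∉ S) :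
    poleOrd t 𝔭 ≠ 1 := by
  have h1 := ht 𝔭 h
  rw [poleOrd_apply]
  unfold primeOrd at h1
  by_cases h0 : t = 0
  · subst h0
    simp [ordCount, FractionalIdeal.count_zero]
  · rw [if_neg h0] at h1
    have h2 : ordCount 𝔭 t ≠ -1 := fun h => h1 (congrArg _ h)
    omega

lemma norm_embedding_eq_zpow (𝔭 : HeightOneSpectrum (𝓞 K)) {t : K} (ht : t ≠ 0) :
    ‖FinitePlace.embedding 𝔭 t‖ = (Ideal.absNorm 𝔭.asIdeal : ℝ) ^ (-ordCount 𝔭 t) := by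
  classical
  obtain ⟨a, b, hb, rfl⟩ := IsFractionRing.div_surjective (A := 𝓞 K) t
  have hb0 : b ≠ 0 := nonZeroDivisors.ne_zero hb
  have ha0 : a ≠ 0 := by rintro rfl; simp at ht
  have hN : (Ideal.absNorm 𝔭.asIdeal : ℝ) ≠ 0 := by
    have := HeightOneSpectrum.one_lt_absNorm 𝔭
    positivity
  have hint {x : 𝓞 K} (hx : x ≠ 0) : ‖FinitePlace.embedding 𝔭 (algebraMap (𝓞 K) K x)‖ =
      (Ideal.absNorm 𝔭.asIdeal : ℝ) ^
        (-((Associates.mk 𝔭.asIdeal).count (Associates.mk (Ideal.span {x})).factors : ℤ)) := by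
    have := HeightOneSpectrum.embedding_mul_absNorm K 𝔭 hx
    rw [zpow_neg]
    refine eq_inv_of_mul_eq_one_left ?_
    simpa [HeightOneSpectrum.maxPowDividing] using this
  have hcount : ordCount 𝔭 (algebraMap (𝓞 K) K a / algebraMap (𝓞 K) K b) =
      (Associates.mk 𝔭.asIdeal).count (Associates.mk (Ideal.span {a})).factors -
      (Associates.mk 𝔭.asIdeal).count (Associates.mk (Ideal.span {b})).factors := by
    refine FractionalIdeal.count_well_defined K 𝔭 ?_ ?_
    · exact FractionalIdeal.spanSingleton_ne_zero_iff.2 ht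
    · rw [FractionalIdeal.coeIdeal_span_singleton, FractionalIdeal.spanSingleton_mul_spanSingleton,
        div_eq_inv_mul]
  rw [map_div₀, norm_div, hint ha0, hint hb0, hcount, ← zpow_sub₀ hN]
  congr 1
  ring

lemma max_norm_embedding_one (𝔭 : HeightOneSpectrum (𝓞 K)) (t : K) :
    max ‖FinitePlace.embedding 𝔭 t‖ 1 = (Ideal.absNorm 𝔭.asIdeal : ℝ) ^ (poleOrd t 𝔭) := by
  have hN : 1 < (Ideal.absNorm 𝔭.asIdeal : ℝ) := by
    exact_mod_cast HeightOneSpectrum.one_lt_absNorm 𝔭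
  rw [poleOrd_apply]
  by_cases ht : t = 0
  · subst ht
    simp [ordCount, FractionalIdeal.count_zero]
  · rw [norm_embedding_eq_zpow 𝔭 ht]
    rcases le_total 0 (-ordCount 𝔭 t) with h | h
    · rw [max_eq_left (one_le_zpow₀ hN.le h), ← zpow_natCast, Int.toNat_of_nonneg h]
    · rw [max_eq_right (zpow_le_one_of_nonpos₀ hN.le h), Int.toNat_of_nonpos h, pow_zero]

lemma finprod_max_one (t : K) : ∏ᶠ w : FinitePlace K, max (w t) 1 = expNorm (poleOrd t) := by
  rw [← finprod_comp_equiv FinitePlace.equivHeightOneSpectrum.symm]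
  simp only [FinitePlace.equivHeightOneSpectrum_symm_apply]
  simp only [max_norm_embedding_one]
  rw [finprod_eq_prod_of_mulSupport_subset (s := (poleOrd t).support)]
  · simp [expNorm, Finsupp.prod]
  · intro v hv
    simp only [Finset.mem_coe, Finsupp.mem_support_iff]
    intro h
    simp [h] at hv

lemma mulHeight₁_eq_prod_mul_expNorm (t : K) :
    Height.mulHeight₁ t =
      (∏ v : InfinitePlace K, max (v t) 1 ^ v.mult) * expNorm (poleOrd t) := by
  rw [mulHeight₁_eq, finprod_max_one]

/-- Distinct elements with the same denominator ideal are not too close. -/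
lemma one_le_prod_sub_mul_expNorm {t u : K} (h : poleOrd t = poleOrd u) (hne : t ≠ u) :
    1 ≤ (∏ v : InfinitePlace K, v (t - u) ^ v.mult) * expNorm (poleOrd t) := by
  have hs : t - u ≠ 0 := sub_ne_zero.2 hne
  have hmax (w : FinitePlace K) : max (w t) 1 = max (w u) 1 := by
    rw [← FinitePlace.norm_embedding_eq, ← FinitePlace.norm_embedding_eq,
      max_norm_embedding_one, max_norm_embedding_one, h]
  -- The product formula for `t - u` replaces 1. At a finite place the ultrametric inequality bounds
  -- `|t - u|_w` by `max(|t|_w, 1)`, which is the same for `u`.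
  rw [← prod_abs_eq_one hs, ← finprod_max_one]
  refine mul_le_mul_of_nonneg_left ?_
    (Finset.prod_nonneg fun v _ => pow_nonneg (apply_nonneg v _) _)
  refine finprod_le_finprod (FinitePlace.hasFiniteMulSupport hs) (fun w => apply_nonneg w _) ?_ ?_
  · by_cases ht : t = 0
    · simp [ht, Function.HasFiniteMulSupport]
    · have := FinitePlace.hasFiniteMulSupport ht
      fun_prop
  · intro w
    have h1 : w (t - u) ≤ max (w t) (w u) := by
      have := FinitePlace.add_le w t (-u)
      rwa [map_neg_eq_map, ← sub_eq_add_neg] at this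
    refine h1.trans (max_le (le_max_left _ _) ?_)
    exact (le_max_left _ _).trans (hmax w).ge

/-! ### Counting in boxes and dyadic covering -/

lemma floor_scale_mem_Icc {x b : ℝ} (hb : 0 < b) (L : ℕ) (h : |x| ≤ b) :
    ⌊x * L / b⌋ ∈ Finset.Icc (-(L : ℤ)) L := by
  have hL : (0 : ℝ) ≤ L := L.cast_nonneg
  obtain ⟨h1, h2⟩ := abs_le.1 h
  rw [Finset.mem_Icc]
  constructor
  · rw [Int.le_floor, le_div_iff₀ hb]
    push_cast
    nlinarith
  · refine Int.floor_le_iff.2 ?_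
    have : x * L / b ≤ L := by
      rw [div_le_iff₀ hb]
      nlinarith
    push_cast
    linarith

lemma abs_sub_le_of_floor_scale_eq {x y b : ℝ} (hb : 0 < b) {L : ℕ} (hL : 0 < L)
    (h : ⌊x * L / b⌋ = ⌊y * L / b⌋) : |x - y| ≤ b / L := by
  have hL' : (0 : ℝ) < L := by exact_mod_cast hL
  have h1 := (Int.abs_sub_lt_one_of_floor_eq_floor h).le
  have h2 : x * L / b - y * L / b = (x - y) * (L / b) := by ring
  rw [h2, abs_mul, abs_of_pos (div_pos hL' hb)] at h1
  rw [le_div_iff₀ hL']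
  rwa [← mul_div_assoc, div_le_one hb] at h1

/-- Elements with a given denominator ideal in a box at the infinite places: by the product
formula, a cell of a sufficiently fine subdivision of the box contains at most one of them. -/
lemma card_le_of_poleOrd_eq_of_le (e : HeightOneSpectrum (𝓞 K) →₀ ℕ) (D : InfinitePlace K → ℝ)
    (hD : ∀ v, 0 < D v) (h1 : 1 ≤ (∏ v, D v) * expNorm e) (F : Finset K)
    (hF : ∀ t ∈ F, poleOrd t = e ∧ ∀ v : InfinitePlace K, v t ^ v.mult ≤ D v) :
    (F.card : ℝ) ≤ 7 ^ Module.finrank ℚ K * ((∏ v, D v) * expNorm e) := by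
  classical
  set n := Module.finrank ℚ K with hn
  have hn0 : n ≠ 0 := Module.finrank_pos.ne'
  set W : ℝ := (∏ v, D v) * expNorm e with hW
  set ρ : ℝ := W ^ (1 / (n : ℝ)) with hρ
  have hρn : ρ ^ n = W := by
    rw [hρ, one_div, Real.rpow_inv_natCast_pow (by linarith) hn0]
  have hρ1 : 1 ≤ ρ := Real.one_le_rpow h1 (by positivity)
  -- `L > 2ρ` makes the cells fine enough for injectivity, the 2 coming from `|z| ≤ |re z| + |im
  -- z|`. Also `L ≤ 3ρ` and `ρ ≥ 1` give `2L + 1 ≤ 7ρ`, the source of the 7.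
  set L : ℕ := ⌊2 * ρ⌋₊ + 1 with hL
  have hLgt : 2 * ρ < L := by rw [hL]; push_cast; exact Nat.lt_floor_add_one _
  have hLle : (L : ℝ) ≤ 3 * ρ := by
    have := Nat.floor_le (by positivity : 0 ≤ 2 * ρ)
    rw [hL]; push_cast; linarith
  set B : InfinitePlace K → ℝ := fun v => D v ^ (1 / (v.mult : ℝ)) with hB
  have hB0 (v) : 0 < B v := Real.rpow_pos_of_pos (hD v) _
  have hBm (v : InfinitePlace K) : B v ^ v.mult = D v := by
    simp only [hB]
    rw [one_div, Real.rpow_inv_natCast_pow (hD v).le v.mult_ne_zero]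
  let c : K → InfinitePlace K → ℤ × ℤ := fun t v =>
    (⌊(v.embedding t).re * L / B v⌋, ⌊(v.embedding t).im * L / B v⌋)
  -- A real place has one free coordinate and a complex place two, `n` in total.
  let T : Finset (InfinitePlace K → ℤ × ℤ) := Fintype.piFinset fun v =>
    Finset.Icc (-(L : ℤ)) L ×ˢ (if v.IsReal then {0} else Finset.Icc (-(L : ℤ)) L)
  have hT : T.card = (2 * L + 1) ^ n := by
    rw [Fintype.card_piFinset, hn, ← InfinitePlace.sum_mult_eq (K := K), ← Finset.prod_pow_eq_pow_sum]
    refine Finset.prod_congr rfl fun v _ => ?_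
    have h2 : (Finset.Icc (-(L : ℤ)) L).card = 2 * L + 1 := by
      rw [Int.card_Icc]; omega
    rw [Finset.card_product, h2, InfinitePlace.mult]
    split_ifs
    · simp
    · rw [h2, sq]
  have hmaps : Set.MapsTo c F T := by
    intro t ht
    simp only [T, Finset.mem_coe, Fintype.mem_piFinset]
    intro v
    have hv : ‖v.embedding t‖ ≤ B v := by
      rw [InfinitePlace.norm_embedding_eq]
      refine le_of_pow_le_pow_left₀ v.mult_ne_zero (hB0 v).le ?_
      rw [hBm]
      exact (hF t ht).2 v
    refine Finset.mem_product.2 ⟨floor_scale_mem_Icc (hB0 v) L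
      ((Complex.abs_re_le_norm _).trans hv), ?_⟩
    split_ifs with hr
    · have : (v.embedding t).im = 0 := by
        rw [← InfinitePlace.embedding_of_isReal_apply hr]
        exact Complex.ofReal_im _
      simp [c, this]
    · exact floor_scale_mem_Icc (hB0 v) L ((Complex.abs_im_le_norm _).trans hv)
  have hinj : Set.InjOn c F := by
    intro t ht u hu h
    by_contra hne
    have h2 := one_le_prod_sub_mul_expNorm ((hF t ht).1.trans (hF u hu).1.symm) hne
    rw [(hF t ht).1] at h2
    have h3 (v : InfinitePlace K) : v (t - u) ≤ B v * (2 / L) := by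
      have hre := abs_sub_le_of_floor_scale_eq (hB0 v) (Nat.succ_pos _)
        (congrArg Prod.fst (congrFun h v))
      have him := abs_sub_le_of_floor_scale_eq (hB0 v) (Nat.succ_pos _)
        (congrArg Prod.snd (congrFun h v))
      rw [← InfinitePlace.norm_embedding_eq, map_sub]
      refine (Complex.norm_le_abs_re_add_abs_im _).trans ?_
      rw [Complex.sub_re, Complex.sub_im]
      refine (add_le_add hre him).trans (le_of_eq ?_)
      ring
    have h4 : ∏ v : InfinitePlace K, v (t - u) ^ v.mult ≤ (∏ v, D v) * (2 / L) ^ n := by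
      rw [hn, ← InfinitePlace.sum_mult_eq (K := K), ← Finset.prod_pow_eq_pow_sum, ← Finset.prod_mul_distrib]
      refine Finset.prod_le_prod (fun v _ => pow_nonneg (apply_nonneg v _) _) fun v _ => ?_
      rw [← hBm, ← mul_pow]
      exact pow_le_pow_left₀ (apply_nonneg v _) (h3 v) _
    have h5 : 1 ≤ (ρ * (2 / L)) ^ n := by
      rw [mul_pow, hρn]
      calc 1 ≤ _ := h2
        _ ≤ ((∏ v, D v) * (2 / L) ^ n) * expNorm e := by gcongr
        _ = _ := by rw [hW]; ring
    have hL0 : (0 : ℝ) < L := by positivity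
    have h6 : ρ * (2 / L) < 1 := by
      rw [← mul_div_assoc, div_lt_one hL0]
      linarith
    exact absurd h5 (not_le.2 (pow_lt_one₀ (by positivity) h6 hn0))
  have hcard := Finset.card_le_card_of_injOn c hmaps hinj
  rw [hT] at hcard
  calc (F.card : ℝ) ≤ (2 * L + 1 : ℝ) ^ n := by exact_mod_cast hcard
    _ ≤ (7 * ρ) ^ n := by gcongr; linarith
    _ = _ := by rw [mul_pow, hρn]

lemma one_le_prod_max_one (t : K) : 1 ≤ ∏ v : InfinitePlace K, max (v t) 1 ^ v.mult :=
  Finset.prod_induction _ (fun x : ℝ => 1 ≤ x) (fun _ _ => one_le_mul_of_one_le_of_one_le) le_rfl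
    fun _ _ => one_le_pow₀ (le_max_right _ _)

lemma exists_le_two_pow_le {y : ℝ} (hy : 1 ≤ y) : ∃ k : ℕ, y ≤ 2 ^ k ∧ (2 : ℝ) ^ k ≤ 2 * y := by
  obtain ⟨k, hk1, hk2⟩ := exists_nat_pow_near hy (one_lt_two : (1 : ℝ) < 2)
  exact ⟨k + 1, hk2.le, by rw [pow_succ]; linarith⟩

/-- Elements with a given denominator ideal and bounded height: cover the region
`∏ max(|t|_v, 1) ^ n_v ≤ Z` by dyadic boxes. -/
lemma card_le_of_poleOrd_eq_of_mulHeight₁_le (e : HeightOneSpectrum (𝓞 K) →₀ ℕ) {X : ℝ}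
    (hX : 2 ≤ X) (F : Finset K)
    (hF : ∀ t ∈ F, poleOrd t = e ∧ Height.mulHeight₁ t ≤ X ^ Module.finrank ℚ K) :
    (F.card : ℝ) ≤ ((Units.rank K + 2 + Module.finrank ℚ K) * (Real.log X / Real.log 2)) ^
        Units.rank K * (7 ^ Module.finrank ℚ K * 2 ^ (Units.rank K + 1)) *
      X ^ Module.finrank ℚ K := by
  classical
  set n := Module.finrank ℚ K with hn
  set r := Units.rank K with hr
  have hlog2 : 0 < Real.log 2 := Real.log_pos one_lt_two
  have hlogX : Real.log 2 ≤ Real.log X := Real.log_le_log two_pos hX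
  have hlog1 : 1 ≤ Real.log X / Real.log 2 := (one_le_div hlog2).2 hlogX
  rcases F.eq_empty_or_nonempty with rfl | ⟨t₀, ht₀⟩
  · simp only [Finset.card_empty, Nat.cast_zero]
    positivity
  have hN : (0 : ℝ) < expNorm e := by exact_mod_cast one_le_expNorm e
  set P : K → ℝ := fun t => ∏ v : InfinitePlace K, max (v t) 1 ^ v.mult with hP
  have hP1 (t) : 1 ≤ P t := one_le_prod_max_one t
  set Z : ℝ := X ^ n / expNorm e with hZ
  have hPZ : ∀ t ∈ F, P t ≤ Z := by
    intro t ht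
    have := (hF t ht).2
    rw [mulHeight₁_eq_prod_mul_expNorm, (hF t ht).1] at this
    exact (le_div_iff₀ hN).2 this
  have hZ1 : 1 ≤ Z := (hP1 t₀).trans (hPZ t₀ ht₀)
  obtain ⟨q, hq1, hq2⟩ := exists_nat_pow_near hZ1 (one_lt_two : (1 : ℝ) < 2)
  obtain ⟨v₀⟩ : Nonempty (InfinitePlace K) := inferInstance
  have hcardv : Fintype.card (InfinitePlace K) = r + 1 := by
    have : 0 < Fintype.card (InfinitePlace K) := Fintype.card_pos
    rw [hr, Units.rank]; omega
  have hcardv' : Fintype.card {v : InfinitePlace K // v ≠ v₀} = r := by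
    rw [Fintype.card_subtype_compl, hcardv]; simp
  have hk (t : K) (v : InfinitePlace K) := exists_le_two_pow_le
    (one_le_pow₀ (le_max_right (v t) 1) : 1 ≤ max (v t) 1 ^ v.mult)
  choose k hk1 hk2 using hk
  -- Rounding up to powers of 2 costs at most a factor 2 at each of the `r + 1` places, and `2 ^ q ≤
  -- Z < 2 ^ (q + 1)`.
  set M : ℕ := r + 1 + q with hM
  have hksum : ∀ t ∈ F, ∑ v, k t v ≤ M := by
    intro t ht
    have h1 : (2 : ℝ) ^ (∑ v, k t v) ≤ 2 ^ (r + 1) * P t := by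
      rw [← Finset.prod_pow_eq_pow_sum, ← hcardv, hP, ← Finset.card_univ, ← Finset.prod_const,
        ← Finset.prod_mul_distrib]
      exact Finset.prod_le_prod (fun v _ => by positivity) fun v _ => hk2 t v
    have h2 : (2 : ℝ) ^ (∑ v, k t v) < 2 ^ (r + 1 + (q + 1)) := by
      rw [pow_add 2 (r + 1)]
      refine h1.trans_lt ?_
      gcongr
      exact (hPZ t ht).trans_lt hq2
    have := (pow_lt_pow_iff_right₀ (one_lt_two : (1 : ℝ) < 2)).1 h2
    omega
  -- The exponent at `v₀` is not recorded, since the bound on the sum controls it; hence the power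
  -- of the logarithm is `r` and not `r + 1`.
  let T : Finset ({v : InfinitePlace K // v ≠ v₀} → ℕ) :=
    Fintype.piFinset fun _ => Finset.range (M + 1)
  let κ : K → {v : InfinitePlace K // v ≠ v₀} → ℕ := fun t v => k t v
  have hsplit (f : InfinitePlace K → ℕ) :
      ∑ v, f v = f v₀ + ∑ v : {v : InfinitePlace K // v ≠ v₀}, f v :=
    Fintype.sum_eq_add_sum_subtype_ne f v₀
  have hmaps : ∀ t ∈ F, κ t ∈ T := by
    intro t ht
    refine Fintype.mem_piFinset.2 fun v => Finset.mem_range.2 (Nat.lt_succ_of_le ?_)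
    exact (Finset.single_le_sum (fun _ _ => Nat.zero_le _) (Finset.mem_univ v.1)).trans (hksum t ht)
  have hfib : ∀ g ∈ T, ((F.filter fun t => κ t = g).card : ℝ) ≤
      7 ^ n * 2 ^ (r + 1) * X ^ n := by
    intro g _
    rcases (F.filter fun t => κ t = g).eq_empty_or_nonempty with h0 | ⟨t₁, ht₁⟩
    · rw [h0, Finset.card_empty, Nat.cast_zero]
      positivity
    have hgM : ∀ t ∈ F, κ t = g → k t v₀ + ∑ v, g v ≤ M := by
      intro t ht h
      rw [← h, ← hsplit]
      exact hksum t ht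
    -- The place `v₀` takes all the remaining room, so that the product is exactly `2 ^ M`. The
    -- subtraction does not truncate because the fibre is nonempty.
    let D : InfinitePlace K → ℝ := fun v =>
      2 ^ (if h : v ≠ v₀ then g ⟨v, h⟩ else M - ∑ v, g v)
    have hDprod : ∏ v, D v = 2 ^ M := by
      simp only [D]
      rw [Finset.prod_pow_eq_pow_sum, hsplit]
      congr 1
      have h1 : ∑ v : {v : InfinitePlace K // v ≠ v₀},
          (if h : (v : InfinitePlace K) ≠ v₀ then g ⟨v, h⟩ else M - ∑ v, g v) = ∑ v, g v :=
        Finset.sum_congr rfl fun v _ => by rw [dif_pos v.2]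
      rw [h1, dif_neg (by simp)]
      have := hgM t₁ (Finset.mem_filter.1 ht₁).1 (Finset.mem_filter.1 ht₁).2
      omega
    have hN1 : (1 : ℝ) ≤ expNorm e := by exact_mod_cast one_le_expNorm e
    have hbox := card_le_of_poleOrd_eq_of_le e D (fun v => by positivity)
      (by rw [hDprod]; exact one_le_mul_of_one_le_of_one_le (one_le_pow₀ one_le_two) hN1)
      (F.filter fun t => κ t = g) (by
        intro t ht
        obtain ⟨ht, htg⟩ := Finset.mem_filter.1 ht
        refine ⟨(hF t ht).1, fun v => ?_⟩
        have h1 : v t ^ v.mult ≤ 2 ^ k t v :=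
          (pow_le_pow_left₀ (apply_nonneg v _) (le_max_left _ _) _).trans (hk1 t v)
        refine h1.trans (pow_le_pow_right₀ one_le_two ?_)
        split_ifs with hv
        · rw [← htg]
        · rw [not_not.1 hv]
          have := hgM t ht htg
          omega)
    rw [hDprod] at hbox
    refine hbox.trans ?_
    have h3 : (2 : ℝ) ^ M * expNorm e ≤ 2 ^ (r + 1) * X ^ n := by
      rw [hM, pow_add, mul_assoc]
      gcongr
      exact (le_div_iff₀ hN).1 hq1
    rw [mul_assoc]
    gcongr
  have hqlog : (q : ℝ) ≤ n * (Real.log X / Real.log 2) := by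
    rw [← mul_div_assoc, le_div_iff₀ hlog2, ← Real.log_pow, ← Real.log_pow]
    refine Real.log_le_log (by positivity) (hq1.trans ?_)
    exact div_le_self (by positivity) (by exact_mod_cast one_le_expNorm e)
  have hM1 : (M + 1 : ℝ) ≤ (r + 2 + n) * (Real.log X / Real.log 2) := by
    rw [hM]; push_cast
    have : (r + 2 : ℝ) * 1 ≤ (r + 2) * (Real.log X / Real.log 2) := by gcongr
    linarith
  rw [Finset.card_eq_sum_card_fiberwise hmaps]
  push_cast
  calc _ ≤ ∑ g ∈ T, (7 ^ n * 2 ^ (r + 1) * X ^ n : ℝ) := Finset.sum_le_sum hfib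
    _ = (M + 1 : ℝ) ^ r * (7 ^ n * 2 ^ (r + 1) * X ^ n) := by
        have hT : T.card = (M + 1) ^ r := by
          rw [Fintype.card_piFinset, Finset.prod_const, Finset.card_range, Finset.card_univ,
            hcardv']
        rw [Finset.sum_const, nsmul_eq_mul, hT]
        push_cast
        rfl
    _ ≤ ((r + 2 + n) * (Real.log X / Real.log 2)) ^ r * (7 ^ n * 2 ^ (r + 1) * X ^ n) := by
        gcongr
    _ = _ := by ring

lemma mulHeight₁_le_of_absHeight_le {t : K} {X : ℝ} (h : absHeight t ≤ X) :
    Height.mulHeight₁ t ≤ X ^ Module.finrank ℚ K := by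
  have h0 : 0 ≤ Height.mulHeight₁ t := zero_le_one.trans (Height.one_le_mulHeight₁ t)
  have h1 := pow_le_pow_left₀ (Real.rpow_nonneg h0 _) h (Module.finrank ℚ K)
  rwa [one_div, Real.rpow_inv_natCast_pow h0 Module.finrank_pos.ne'] at h1

end NumberField

end

/-! ### Summing over denominators -/

theorem lemma6p3 (K : Type*) [Field K] [NumberField K] (s : ℕ) :
    ∃ C : ℝ, ∀ S : Finset (IsDedekindDomain.HeightOneSpectrum (NumberField.RingOfIntegers K)),
      S.card = s → ∀ X : ℝ, 2 ≤ X →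
        (NumberField.upToHeight (NumberField.noSimplePoleOutside S) X).Finite ∧
        (NumberField.heightCount (NumberField.noSimplePoleOutside S) X : ℝ) ≤
          C * X ^ (3 * (Module.finrank ℚ K : ℝ) / 2) *
            Real.log X ^ NumberField.Units.rank K := by
  classical
  obtain ⟨C₁, hC₁0, hC₁⟩ := exists_card_almost_squarefull_le K s
  set n := Module.finrank ℚ K with hn
  set r := Units.rank K with hr
  set A : ℝ := ((r + 2 + n) / Real.log 2) ^ r * (7 ^ n * 2 ^ (r + 1)) with hA
  refine ⟨C₁ * A, fun S hS X hX => ?_⟩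
  have hX0 : 0 < X := by linarith
  have hlogX : 0 < Real.log X := Real.log_pos (by linarith)
  -- Northcott's theorem.
  have hfin : (upToHeight (noSimplePoleOutside S) X).Finite :=
    (finite_setOfPred_mulHeight₁_le K (X ^ n)).subset fun t ht => mulHeight₁_le_of_absHeight_le ht.2
  refine ⟨hfin, ?_⟩
  rw [heightCount, Set.ncard_eq_toFinset_card _ hfin]
  set F := hfin.toFinset with hF
  have hmem : ∀ t ∈ F, t ∈ noSimplePoleOutside S ∧ Height.mulHeight₁ t ≤ X ^ n := fun t ht =>
    have ht := hfin.mem_toFinset.1 ht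
    ⟨ht.1, mulHeight₁_le_of_absHeight_le ht.2⟩
  have himg : ((F.image poleOrd).card : ℝ) ≤ C₁ * (X ^ n) ^ (1 / 2 : ℝ) := by
    refine hC₁ S hS _ (by positivity) _ fun e he => ?_
    obtain ⟨t, ht, rfl⟩ := Finset.mem_image.1 he
    obtain ⟨h1, h2⟩ := hmem t ht
    refine ⟨le_trans ?_ h2, fun v hv => poleOrd_ne_one h1 hv⟩
    rw [mulHeight₁_eq_prod_mul_expNorm]
    exact le_mul_of_one_le_left (Nat.cast_nonneg _) (one_le_prod_max_one t)
  have hfib : ∀ e ∈ F.image poleOrd, ((F.filter fun t => poleOrd t = e).card : ℝ) ≤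
      A * Real.log X ^ r * X ^ n := by
    intro e _
    refine (card_le_of_poleOrd_eq_of_mulHeight₁_le e hX _ fun t ht => ?_).trans (le_of_eq ?_)
    · obtain ⟨ht, hte⟩ := Finset.mem_filter.1 ht
      exact ⟨hte, (hmem t ht).2⟩
    · rw [hA, ← mul_div_assoc, mul_div_right_comm, mul_pow]
      ring
  rw [Finset.card_eq_sum_card_image poleOrd F]
  push_cast
  calc _ ≤ ∑ e ∈ F.image poleOrd, A * Real.log X ^ r * X ^ n := Finset.sum_le_sum hfib
    _ = (F.image poleOrd).card * (A * Real.log X ^ r * X ^ n) := by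
        rw [Finset.sum_const, nsmul_eq_mul]
    _ ≤ C₁ * (X ^ n) ^ (1 / 2 : ℝ) * (A * Real.log X ^ r * X ^ n) := by
        have : 0 ≤ A := by
          have := Real.log_pos one_lt_two
          positivity
        gcongr
    _ = C₁ * A * X ^ (3 * (n : ℝ) / 2) * Real.log X ^ r := by
        have : X ^ (3 * (n : ℝ) / 2) = (X ^ n) ^ (1 / 2 : ℝ) * X ^ n := by
          rw [← Real.rpow_natCast, ← Real.rpow_mul hX0.le, ← Real.rpow_add hX0]
          congr 1
          ring
        rw [this]
        ring
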